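/- Let $K_p,K_i,K_d,F_c>0$ and consider the PID-controlled unit mass with discontinuous Coulomb friction $$\dot x = Ax+Bu,\qquad y=Cx,\qquad u\in-\operatorname{sign}(y),\qquad x=(x_1,x_2,x_3)^T\in\mathbb R^3,$$ $$A=\begin{pmatrix}0&1&0\\0&0&1\\-K_i&-K_p&-K_d\end{pmatrix},\quad B=\begin{pmatrix}0\\0\\F_c\end{pmatrix},\quad C=(0,0,1),$$ where $\operatorname{sign}$ is set-valued: $\operatorname{sign}(z)=\{1\}$ for $z>0$, $\operatorname{sign}(0)=[-1,1]$, $\operatorname{sign}(z)=\{-1\}$ for $z<0$. A trajectory on $[t_0,\infty)$ is a Filippov solution, i.e. a function $x:[t_0,\infty)\to\mathbb R^3$ that is absolutely continuous on compact intervals and satisfies the inclusion for almost every $t>t_0$. Assume the Routh–Hurwitz condition $K_dK_p>K_i$ of the linear part. Then the stiction region $$S_0=\{x\in\mathbb R^3:\ x_3=0,\ |K_ix_1|+|K_px_2|\le F_c\}$$ is globally attractive for all initial values outside of it: for every $t_0\in\mathbb R$ and every trajectory $x$ on $[t_0,\infty)$ with $x(t_0)\in\mathbb R^3\setminus S_0$,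 $$\operatorname{dist}(x(t),S_0)\to 0\qquad\text{as } t\to\infty .$$ -/

import Mathlib

open MeasureTheory Filter Topology
open scoped Matrix

/-- The state space `ℝ³` with its Euclidean norm. The entries `x 0`, `x 1`, `x 2` of a state are
the integral error `x₁`, the output error `x₂` and the derivative error (velocity) `x₃`. -/
abbrev PIDState : Type := EuclideanSpace ℝ (Fin 3)

/-- The system matrix `A` of the PID loop with gains `Kp`, `Ki`, `Kd`. -/
def pidMatrix (Kp Ki Kd : ℝ) : Matrix (Fin 3) (Fin 3) ℝ :=
  !![0, 1, 0;
     0, 0, 1;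
     -Ki, -Kp, -Kd]

/-- The input vector `B = (0, 0, F_c)ᵀ`. -/
def pidInput (Fc : ℝ) : Fin 3 → ℝ := ![0, 0, Fc]

/-- The output vector `C = (0, 0, 1)`. -/
def pidOutput : Fin 3 → ℝ := ![0, 0, 1]

/-- The set-valued sign of the Coulomb friction law:
`{1}` for `z > 0`, `[-1, 1]` for `z = 0`, `{-1}` for `z < 0`. -/
def setSign (z : ℝ) : Set ℝ :=
  {s | (0 < z → s = 1) ∧ (z = 0 → s ∈ Set.Icc (-1 : ℝ) 1) ∧ (z < 0 → s = -1)}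

/-- The right-hand side of the relay feedback system `ẋ = A x + B u`, `y = C x`, `u ∈ -sign y`,
as a set-valued vector field. -/
def coulombField (Kp Ki Kd Fc : ℝ) (x : PIDState) : Set PIDState :=
  {v | ∃ u : ℝ, -u ∈ setSign (pidOutput ⬝ᵥ x.ofLp) ∧
    v = WithLp.toLp 2 (pidMatrix Kp Ki Kd *ᵥ x.ofLp + u • pidInput Fc)}

/-- `x` restricted to `[t₀, ∞)` is a trajectory, i.e. a Filippov solution: it is absolutely
continuous on every compact interval `[t₀, T]` and satisfies the differential inclusion at almost
every `t > t₀`. -/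
def IsTrajectory (Kp Ki Kd Fc t₀ : ℝ) (x : ℝ → PIDState) : Prop :=
  (∀ T, t₀ ≤ T → AbsolutelyContinuousOnInterval x t₀ T) ∧
    ∀ᵐ t ∂(volume : Measure ℝ), t₀ < t → ∃ v ∈ coulombField Kp Ki Kd Fc (x t), HasDerivAt x v t

/-- The stiction region `S₀ = {x : x₃ = 0, |K_i x₁| + |K_p x₂| ≤ F_c}`. -/
def stictionRegion (Kp Ki Fc : ℝ) : Set PIDState :=
  {x | x 2 = 0 ∧ |Ki * x 0| + |Kp * x 1| ≤ Fc}

/-- The set `S` attracts the initial state `x₀`: every trajectory that starts in `x₀`, at whatever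
initial time, approaches `S`, i.e. its distance to `S` tends to zero as time tends to infinity. -/
def Attracts (Kp Ki Kd Fc : ℝ) (S : Set PIDState) (x₀ : PIDState) : Prop :=
  ∀ (t₀ : ℝ) (x : ℝ → PIDState), IsTrajectory Kp Ki Kd Fc t₀ x → x t₀ = x₀ →
    Tendsto (fun t => Metric.infDist (x t) S) atTop (𝓝 0)

/-! Put φ = -Ki x₁ - Kp x₂, so that v' = φ - Kd v - f with friction f in Fc sign(v). The Lyapunov
function is V = Kd Ki x₂² + 2 Ki x₂ v + Kp v² + min (φ - f)², the minimum being over the f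
admissible at v. During slip V' = -2 (Kd Kp - Ki) v². V is discontinuous at v = 0 but lower
semicontinuous, so arrival at rest can only lower it. `energy_step` shows that V plus the dissipated
energy starts to grow at no instant, and `LowerSemicontinuous.le_of_forall_exists_gt` makes this
global, whatever the pattern of stick and slip phases.

By Routh–Hurwitz the quadratic part is positive definite, so x₂, v, φ and ∫ v² are bounded; v is
Lipschitz, and Barbalat gives v → 0. In place of an invariance principle, the force balance is
averaged over a window of length T (`eventually_abs_force_le`). There φ is nearly affine with slope
-Ki x₂, so its mean φ - Ki x₂ T/2 is at most Fc in modulus up to a small error. Since φ is bounded,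
large T forces x₂ → 0; then T = 1 bounds |Ki x₁| by Fc in the limit. -/

/-! ### From the differential inclusion to integrated friction laws -/

/-- A function whose derivative is almost everywhere within `C` of the continuous derivative of `w`
has increments within `C (b - a)` of those of `w`. -/
theorem AbsolutelyContinuousOnInterval.abs_sub_sub_le {f w w' : ℝ → ℝ} {a b C : ℝ} (hab : a ≤ b)
    (hf : AbsolutelyContinuousOnInterval f a b) (hw : ∀ t, HasDerivAt w (w' t) t)
    (hw' : Continuous w')
    (h : ∀ᵐ t, a < t → t < b → ∃ d, HasDerivAt f d t ∧ |d - w' t| ≤ C) :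
    |(f b - f a) - (w b - w a)| ≤ C * (b - a) := by
  rw [← hf.integral_deriv_eq_sub,
    ← intervalIntegral.integral_eq_sub_of_hasDerivAt (fun t _ => hw t) (hw'.intervalIntegrable a b),
    ← intervalIntegral.integral_sub hf.intervalIntegrable_deriv (hw'.intervalIntegrable a b),
    ← Real.norm_eq_abs, ← abs_of_nonneg (sub_nonneg.2 hab)]
  apply intervalIntegral.norm_integral_le_of_norm_le_const_ae
  have hb : ∀ᵐ t : ℝ, t ≠ b := by simp [ae_iff, measure_singleton]
  filter_upwards [h, hb] with t ht htb hm
  rw [Set.uIoc_of_le hab] at hm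
  obtain ⟨d, hd, hC⟩ := ht hm.1 (lt_of_le_of_ne hm.2 htb)
  rwa [hd.deriv, Real.norm_eq_abs]

theorem AbsolutelyContinuousOnInterval.euclidean_apply {n : ℕ} {x : ℝ → EuclideanSpace ℝ (Fin n)}
    {a b : ℝ} (hx : AbsolutelyContinuousOnInterval x a b) (i : Fin n) :
    AbsolutelyContinuousOnInterval (fun t => x t i) a b := by
  rw [absolutelyContinuousOnInterval_iff] at hx ⊢
  intro ε hε
  obtain ⟨δ, hδ, h⟩ := hx ε hε
  refine ⟨δ, hδ, fun E hE hlt => lt_of_le_of_lt (Finset.sum_le_sum fun j _ => ?_) (h E hE hlt)⟩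
  rw [dist_eq_norm, dist_eq_norm, ← PiLp.sub_apply]
  exact PiLp.norm_apply_le _ i

/-- A trajectory in scalar form: `x₁`, `x₂` and `v` are the components of the state, and `w`
integrates the acceleration without its friction term. -/
structure FrictionFlow (Kp Ki Kd Fc t₀ : ℝ) (x₁ x₂ v w : ℝ → ℝ) : Prop where
  deriv_integral : ∀ t, HasDerivAt x₁ (x₂ t) t
  deriv_error : ∀ t, HasDerivAt x₂ (v t) t
  cont : Continuous v
  deriv_free : ∀ t, HasDerivAt w (-Ki * x₁ t - Kp * x₂ t - Kd * v t) t
  friction_le : ∀ a b, t₀ ≤ a → a ≤ b → |(v b - v a) - (w b - w a)| ≤ Fc * (b - a)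
  friction_pos : ∀ a b, t₀ ≤ a → a ≤ b → (∀ t, a < t → t < b → 0 < v t) →
    v b - v a = w b - w a - Fc * (b - a)
  friction_neg : ∀ a b, t₀ ≤ a → a ≤ b → (∀ t, a < t → t < b → v t < 0) →
    v b - v a = w b - w a + Fc * (b - a)

theorem hasDerivAt_add_integral {g : ℝ → ℝ} (hg : Continuous g) (c a t : ℝ) :
    HasDerivAt (fun t => c + ∫ s in a..t, g s) (g t) t :=
  ((hg.integral_hasStrictDerivAt a t).hasDerivAt).const_add c

theorem IsTrajectory.ae_hasDerivAt {Kp Ki Kd Fc t₀ : ℝ} {x : ℝ → PIDState}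
    (hx : IsTrajectory Kp Ki Kd Fc t₀ x) :
    ∀ᵐ t : ℝ, t₀ < t → HasDerivAt (fun t => x t 0) (x t 1) t ∧
      HasDerivAt (fun t => x t 1) (x t 2) t ∧
      ∃ s ∈ setSign (x t 2), HasDerivAt (fun t => x t 2)
        (-Ki * x t 0 - Kp * x t 1 - Kd * x t 2 - Fc * s) t := by
  filter_upwards [hx.2] with t ht h0
  obtain ⟨_, ⟨u, hu, rfl⟩, hd⟩ := ht h0
  have key := fun i => (hasDerivAt_pi.1
    ((PiLp.hasFDerivAt_ofLp (𝕜 := ℝ) 2 (x t)).comp_hasDerivAt t hd)) i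
  refine ⟨?_, ?_, -u, ?_, ?_⟩
  · refine (key 0).congr_deriv ?_
    simp [pidMatrix, pidInput, dotProduct, Fin.sum_univ_three]
  · refine (key 1).congr_deriv ?_
    simp [pidMatrix, pidInput, dotProduct, Fin.sum_univ_three]
  · simpa [pidOutput, dotProduct, Fin.sum_univ_three] using hu
  · refine (key 2).congr_deriv ?_
    simp [pidMatrix, pidInput, dotProduct, Fin.sum_univ_three]
    ring

theorem setSign_abs_le {z s : ℝ} (hs : s ∈ setSign z) : |s| ≤ 1 := by
  rcases lt_trichotomy z 0 with h | h | h
  · simp [hs.2.2 h]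
  · exact abs_le.2 (hs.2.1 h)
  · simp [hs.1 h]

/-- Integrating removes the almost-everywhere quantifier: `x₁`, `x₂`, `w` become primitives of
continuous functions, differentiable at every time, and friction enters only through increments of
`v`. -/
theorem IsTrajectory.exists_frictionFlow {Kp Ki Kd Fc t₀ : ℝ} (hFc : 0 < Fc) {x : ℝ → PIDState}
    (hx : IsTrajectory Kp Ki Kd Fc t₀ x) :
    ∃ x₁ x₂ v w : ℝ → ℝ, FrictionFlow Kp Ki Kd Fc t₀ x₁ x₂ v w ∧
      ∀ t, t₀ ≤ t → x t 0 = x₁ t ∧ x t 1 = x₂ t ∧ x t 2 = v t := by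
  have hac : ∀ i a b, t₀ ≤ a → a ≤ b → AbsolutelyContinuousOnInterval (fun t => x t i) a b :=
    fun i a b ha hab => ((hx.1 b (ha.trans hab)).mono (by
      rw [Set.uIcc_of_le hab, Set.uIcc_of_le (ha.trans hab)]
      exact Set.Icc_subset_Icc_left ha)).euclidean_apply i
  have hae := hx.ae_hasDerivAt
  -- Freezing the velocity before `t₀` makes it continuous on the whole line.
  set v : ℝ → ℝ := fun t => x (max t t₀) 2 with hv
  have hveq : ∀ t, t₀ ≤ t → x t 2 = v t := fun t ht => by simp [hv, max_eq_left ht]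
  have hcont : Continuous v := by
    have h2 : ContinuousOn (fun t => x t 2) (Set.Ici t₀) := by
      intro t ht
      have h := (hac 2 t₀ (t + 1) le_rfl (by linarith [Set.mem_Ici.1 ht])).continuousOn
      rw [Set.uIcc_of_le (by linarith [Set.mem_Ici.1 ht])] at h
      refine (h t ⟨ht, by linarith⟩).mono_of_mem_nhdsWithin ?_
      rw [← Set.Ici_inter_Iic]
      exact inter_mem self_mem_nhdsWithin (mem_nhdsWithin_of_mem_nhds (Iic_mem_nhds (by linarith)))
    exact h2.comp_continuous (by fun_prop) fun t => Set.mem_Ici.2 (le_max_right t t₀)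
  set x₂ : ℝ → ℝ := fun t => x t₀ 1 + ∫ s in t₀..t, v s with hx₂
  have hd₂ : ∀ t, HasDerivAt x₂ (v t) t := hasDerivAt_add_integral hcont _ _
  have hc₂ : Continuous x₂ := continuous_iff_continuousAt.2 fun t => (hd₂ t).continuousAt
  have heq₂ : ∀ t, t₀ ≤ t → x t 1 = x₂ t := by
    intro t ht
    have h := (hac 1 t₀ t le_rfl ht).abs_sub_sub_le (C := 0) ht hd₂ hcont (by
      filter_upwards [hae] with s hs h0 _
      exact ⟨_, (hs h0).2.1, by rw [hveq s h0.le]; simp⟩)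
    have h' : x₂ t₀ = x t₀ 1 := by simp [hx₂]
    rw [zero_mul, abs_nonpos_iff, h'] at h
    linarith
  set x₁ : ℝ → ℝ := fun t => x t₀ 0 + ∫ s in t₀..t, x₂ s with hx₁
  have hd₁ : ∀ t, HasDerivAt x₁ (x₂ t) t := hasDerivAt_add_integral hc₂ _ _
  have hc₁ : Continuous x₁ := continuous_iff_continuousAt.2 fun t => (hd₁ t).continuousAt
  have heq₁ : ∀ t, t₀ ≤ t → x t 0 = x₁ t := by
    intro t ht
    have h := (hac 0 t₀ t le_rfl ht).abs_sub_sub_le (C := 0) ht hd₁ hc₂ (by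
      filter_upwards [hae] with s hs h0 _
      exact ⟨_, (hs h0).1, by rw [heq₂ s h0.le]; simp⟩)
    have h' : x₁ t₀ = x t₀ 0 := by simp [hx₁]
    rw [zero_mul, abs_nonpos_iff, h'] at h
    linarith
  have hcw : Continuous fun t => -Ki * x₁ t - Kp * x₂ t - Kd * v t := by fun_prop
  have hdw := hasDerivAt_add_integral hcw 0 t₀
  refine ⟨x₁, x₂, v, _, ⟨hd₁, hd₂, hcont, hdw, ?_, ?_, ?_⟩,
    fun t ht => ⟨heq₁ t ht, heq₂ t ht, hveq t ht⟩⟩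
  · intro a b ha hab
    have h := (hac 2 a b ha hab).abs_sub_sub_le (C := Fc) hab hdw hcw (by
      filter_upwards [hae] with s hs h0 _
      have h0' := ha.trans_lt h0
      obtain ⟨-, -, u, hu, hd⟩ := hs h0'
      refine ⟨_, hd, ?_⟩
      rw [heq₁ s h0'.le, heq₂ s h0'.le, hveq s h0'.le, sub_sub_cancel_left, abs_neg, abs_mul,
        abs_of_pos hFc]
      exact mul_le_of_le_one_right hFc.le (setSign_abs_le hu))
    rwa [hveq a ha, hveq b (ha.trans hab)] at h
  · intro a b ha hab hpos
    have h := (hac 2 a b ha hab).abs_sub_sub_le (C := 0) hab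
      (fun t => (hdw t).sub ((hasDerivAt_id t).const_mul Fc)) (by fun_prop) (by
      filter_upwards [hae] with s hs h0 h1
      have h0' := ha.trans_lt h0
      obtain ⟨-, -, u, hu, hd⟩ := hs h0'
      refine ⟨_, hd, ?_⟩
      rw [hu.1 (by rw [hveq s h0'.le]; exact hpos s h0 h1)]
      rw [heq₁ s h0'.le, heq₂ s h0'.le, hveq s h0'.le, sub_self, abs_zero])
    rw [hveq a ha, hveq b (ha.trans hab), zero_mul, abs_nonpos_iff] at h
    simp only [Pi.sub_apply, id] at h
    linarith
  · intro a b ha hab hneg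
    have h := (hac 2 a b ha hab).abs_sub_sub_le (C := 0) hab
      (fun t => (hdw t).add ((hasDerivAt_id t).const_mul Fc)) (by fun_prop) (by
      filter_upwards [hae] with s hs h0 h1
      have h0' := ha.trans_lt h0
      obtain ⟨-, -, u, hu, hd⟩ := hs h0'
      refine ⟨_, hd, ?_⟩
      rw [hu.2.2 (by rw [hveq s h0'.le]; exact hneg s h0 h1)]
      rw [heq₁ s h0'.le, heq₂ s h0'.le, hveq s h0'.le, abs_nonpos_iff]
      ring)
    rw [hveq a ha, hveq b (ha.trans hab), zero_mul, abs_nonpos_iff] at h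
    simp only [Pi.add_apply, id] at h
    linarith

/-! ### The discontinuous Lyapunov function -/

/-- The least value of `(φ - f)²` over the friction forces `f` that are admissible at velocity
`v`. -/
noncomputable def frictionPenalty (Fc v φ : ℝ) : ℝ :=
  if 0 < v then (φ - Fc) ^ 2 else if v < 0 then (φ + Fc) ^ 2 else (max (|φ| - Fc) 0) ^ 2

theorem frictionPenalty_pos {Fc v φ : ℝ} (hv : 0 < v) : frictionPenalty Fc v φ = (φ - Fc) ^ 2 := by
  simp [frictionPenalty, hv]

theorem frictionPenalty_neg {Fc v φ : ℝ} (hv : v < 0) : frictionPenalty Fc v φ = (φ + Fc) ^ 2 := by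
  simp [frictionPenalty, hv, hv.not_gt]

theorem frictionPenalty_zero {Fc φ : ℝ} : frictionPenalty Fc 0 φ = (max (|φ| - Fc) 0) ^ 2 := by
  simp [frictionPenalty]

theorem frictionPenalty_neg_neg (Fc v φ : ℝ) :
    frictionPenalty Fc (-v) (-φ) = frictionPenalty Fc v φ := by
  rcases lt_trichotomy v 0 with h | rfl | h
  · rw [frictionPenalty_neg h, frictionPenalty_pos (neg_pos.2 h)]; ring
  · simp [frictionPenalty]
  · rw [frictionPenalty_pos h, frictionPenalty_neg (neg_lt_zero.2 h)]; ring

theorem deadzone_sq_le_frictionPenalty {Fc v φ : ℝ} (hFc : 0 < Fc) :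
    (max (|φ| - Fc) 0) ^ 2 ≤ frictionPenalty Fc v φ := by
  have h0 : (0 : ℝ) ≤ max (|φ| - Fc) 0 := le_max_right _ _
  rcases lt_trichotomy v 0 with h | rfl | h
  · rw [frictionPenalty_neg h, ← sq_abs (φ + Fc)]
    gcongr
    refine max_le ?_ (abs_nonneg _)
    have := abs_sub_abs_le_abs_sub φ (-Fc)
    rwa [abs_neg, abs_of_pos hFc, sub_neg_eq_add] at this
  · rw [frictionPenalty_zero]
  · rw [frictionPenalty_pos h, ← sq_abs (φ - Fc)]
    gcongr
    refine max_le ?_ (abs_nonneg _)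
    have := abs_sub_abs_le_abs_sub φ Fc
    rwa [abs_of_pos hFc] at this

/-- Only v = 0 is delicate; there the penalty is the dead-zone term, a continuous lower bound for
all three branches. -/
theorem lowerSemicontinuous_frictionPenalty {Fc : ℝ} (hFc : 0 < Fc) {v φ : ℝ → ℝ}
    (hv : Continuous v) (hφ : Continuous φ) :
    LowerSemicontinuous fun t => frictionPenalty Fc (v t) (φ t) := by
  intro t y hy
  simp only at hy
  rcases lt_trichotomy (v t) 0 with h | h | h
  · rw [frictionPenalty_neg h] at hy
    filter_upwards [hv.continuousAt.eventually_lt_const h,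
      (show Continuous fun s => (φ s + Fc) ^ 2 by fun_prop).continuousAt.eventually_const_lt hy]
      with s hs hs'
    rwa [frictionPenalty_neg hs]
  · rw [h, frictionPenalty_zero] at hy
    filter_upwards [(show Continuous fun s => (max (|φ s| - Fc) 0) ^ 2 by
      fun_prop).continuousAt.eventually_const_lt hy] with s hs
    exact hs.trans_le (deadzone_sq_le_frictionPenalty hFc)
  · rw [frictionPenalty_pos h] at hy
    filter_upwards [hv.continuousAt.eventually_const_lt h,
      (show Continuous fun s => (φ s - Fc) ^ 2 by fun_prop).continuousAt.eventually_const_lt hy]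
      with s hs hs'
    rwa [frictionPenalty_pos hs]

/-- The (discontinuous) Lyapunov function along a flow, plus the energy dissipated so far, where
`J` is a primitive of `v²`. -/
noncomputable def frictionEnergy (Kp Ki Kd Fc : ℝ) (x₁ x₂ v J : ℝ → ℝ) (t : ℝ) : ℝ :=
  Kd * Ki * x₂ t ^ 2 + 2 * Ki * x₂ t * v t + Kp * v t ^ 2 +
    2 * (Kd * Kp - Ki) * J t + frictionPenalty Fc (v t) (-Ki * x₁ t - Kp * x₂ t)

theorem frictionEnergy_neg (Kp Ki Kd Fc : ℝ) (x₁ x₂ v J : ℝ → ℝ) (t : ℝ) :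
    frictionEnergy Kp Ki Kd Fc (-x₁) (-x₂) (-v) J t = frictionEnergy Kp Ki Kd Fc x₁ x₂ v J t := by
  simp only [frictionEnergy, Pi.neg_apply]
  rw [show -Ki * -x₁ t - Kp * -x₂ t = -(-Ki * x₁ t - Kp * x₂ t) by ring, frictionPenalty_neg_neg]
  ring

/-! ### Decay of the energy -/

/-- A lower semicontinuous function that starts to grow at no point does not grow. -/
theorem LowerSemicontinuous.le_of_forall_exists_gt {f : ℝ → ℝ} (hf : LowerSemicontinuous f)
    {a b : ℝ} (hab : a ≤ b)
    (h : ∀ t ∈ Set.Ico a b, ∀ ε > 0, ∀ y > t, ∃ s ∈ Set.Ioc t y, f s ≤ f t + ε * (s - t)) :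
    f b ≤ f a := by
  refine le_of_forall_pos_le_add fun η hη => ?_
  have hε : 0 < η / (b - a + 1) := div_pos hη (by linarith)
  set ε := η / (b - a + 1) with hεdef
  have hlsc : LowerSemicontinuous fun s => f s + -(ε * (s - a)) :=
    hf.add (Continuous.lowerSemicontinuous (by fun_prop))
  -- Lower semicontinuity closes this sublevel set, so continuation to the right from `a` reaches
  -- `b`.
  have hcl := (hlsc.isClosed_preimage (f a)).inter (isClosed_Icc (a := a) (b := b))
  have hsub := hcl.Icc_subset_of_forall_exists_gt (by simp) (by
    rintro t ⟨ht, htab⟩ y hy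
    obtain ⟨s, hs, hle⟩ := h t htab ε hε y hy
    refine ⟨s, ?_, hs⟩
    simp only [Set.mem_preimage, Set.mem_Iic] at ht ⊢
    linarith)
  have hb := hsub (Set.right_mem_Icc.2 hab)
  simp only [Set.mem_preimage, Set.mem_Iic] at hb
  have : ε * (b - a) ≤ η := by
    rw [hεdef, div_mul_eq_mul_div, div_le_iff₀ (by linarith)]
    nlinarith
  linarith

namespace FrictionFlow

variable {Kp Ki Kd Fc t₀ : ℝ} {x₁ x₂ v w J : ℝ → ℝ}

theorem neg (H : FrictionFlow Kp Ki Kd Fc t₀ x₁ x₂ v w) :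
    FrictionFlow Kp Ki Kd Fc t₀ (-x₁) (-x₂) (-v) (-w) where
  deriv_integral t := (H.deriv_integral t).neg
  deriv_error t := (H.deriv_error t).neg
  cont := H.cont.neg
  deriv_free t := (H.deriv_free t).neg.congr_deriv (by simp only [Pi.neg_apply]; ring)
  friction_le a b ha hab := by
    have h := H.friction_le a b ha hab
    rw [← abs_neg] at h
    convert h using 2
    simp only [Pi.neg_apply]; ring
  friction_pos a b ha hab h := by
    have := H.friction_neg a b ha hab fun t h₁ h₂ => neg_pos.1 (h t h₁ h₂)
    simp only [Pi.neg_apply]; linarith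
  friction_neg a b ha hab h := by
    have := H.friction_pos a b ha hab fun t h₁ h₂ => neg_lt_zero.1 (h t h₁ h₂)
    simp only [Pi.neg_apply]; linarith

theorem continuous_integral (H : FrictionFlow Kp Ki Kd Fc t₀ x₁ x₂ v w) : Continuous x₁ :=
  continuous_iff_continuousAt.2 fun t => (H.deriv_integral t).continuousAt

theorem continuous_error (H : FrictionFlow Kp Ki Kd Fc t₀ x₁ x₂ v w) : Continuous x₂ :=
  continuous_iff_continuousAt.2 fun t => (H.deriv_error t).continuousAt

theorem hasDerivAt_force (H : FrictionFlow Kp Ki Kd Fc t₀ x₁ x₂ v w) (t : ℝ) :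
    HasDerivAt (fun t => -Ki * x₁ t - Kp * x₂ t) (-Ki * x₂ t - Kp * v t) t :=
  ((H.deriv_integral t).const_mul (-Ki)).sub ((H.deriv_error t).const_mul Kp)

theorem lowerSemicontinuous_energy (H : FrictionFlow Kp Ki Kd Fc t₀ x₁ x₂ v w) (hFc : 0 < Fc)
    (hJ : ∀ t, HasDerivAt J (v t ^ 2) t) :
    LowerSemicontinuous (frictionEnergy Kp Ki Kd Fc x₁ x₂ v J) := by
  have h₁ := H.continuous_integral
  have h₂ := H.continuous_error
  have h₃ := H.cont
  have hJc : Continuous J := continuous_iff_continuousAt.2 fun t => (hJ t).continuousAt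
  exact (Continuous.lowerSemicontinuous (by fun_prop)).add
    (lowerSemicontinuous_frictionPenalty hFc h₃ (by fun_prop))

/-- While the velocity is positive, the dissipated energy accounts for the whole decrease. -/
theorem energy_eq_of_pos (H : FrictionFlow Kp Ki Kd Fc t₀ x₁ x₂ v w)
    (hJ : ∀ t, HasDerivAt J (v t ^ 2) t) {a b : ℝ} (ha : t₀ ≤ a) (hab : a < b)
    (hpos : ∀ t, a < t → t ≤ b → 0 < v t)
    (hpen : frictionPenalty Fc (v a) (-Ki * x₁ a - Kp * x₂ a) =
      (-Ki * x₁ a - Kp * x₂ a - Fc) ^ 2) :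
    frictionEnergy Kp Ki Kd Fc x₁ x₂ v J b = frictionEnergy Kp Ki Kd Fc x₁ x₂ v J a := by
  -- `v` need not be differentiable everywhere; `u` is, and it agrees with `v` on `[a, b]`.
  set u : ℝ → ℝ := fun s => v a + (w s - w a) - Fc * (s - a) with hu
  have huv : ∀ s ∈ Set.Icc a b, v s = u s := fun s hs => by
    have := H.friction_pos a s ha hs.1 fun t h₁ h₂ => hpos t h₁ (h₂.le.trans hs.2)
    simp only [hu]; linarith
  have hud : ∀ s, HasDerivAt u (-Ki * x₁ s - Kp * x₂ s - Kd * v s - Fc) s := fun s => by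
    have := (((H.deriv_free s).sub_const (w a)).const_add (v a)).sub
      (((hasDerivAt_id s).sub_const a).const_mul Fc)
    exact this.congr_deriv (by ring)
  set G : ℝ → ℝ := fun s => Kd * Ki * x₂ s ^ 2 + 2 * Ki * x₂ s * u s + Kp * u s ^ 2 +
    2 * (Kd * Kp - Ki) * J s + (-Ki * x₁ s - Kp * x₂ s - Fc) ^ 2 with hG
  have hGd := fun s => ((((((H.deriv_error s).pow 2).const_mul (Kd * Ki)).add
    (((H.deriv_error s).const_mul (2 * Ki)).mul (hud s))).add (((hud s).pow 2).const_mul Kp)).add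
    ((hJ s).const_mul (2 * (Kd * Kp - Ki)))).add (((H.hasDerivAt_force s).sub_const Fc).pow 2)
  have hGc : ContinuousOn G (Set.Icc a b) := fun s _ => (hGd s).continuousAt.continuousWithinAt
  have hconst := constant_of_has_deriv_right_zero hGc (fun s hs => by
    refine ((hGd s).congr_deriv ?_).hasDerivWithinAt
    rw [← huv s ⟨hs.1, hs.2.le⟩]
    push_cast
    ring) b (Set.right_mem_Icc.2 hab.le)
  have hGa : frictionEnergy Kp Ki Kd Fc x₁ x₂ v J a = G a := by
    rw [frictionEnergy, hpen, huv a (Set.left_mem_Icc.2 hab.le)]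
  have hGb : frictionEnergy Kp Ki Kd Fc x₁ x₂ v J b = G b := by
    rw [frictionEnergy, frictionPenalty_pos (hpos b hab le_rfl), huv b (Set.right_mem_Icc.2 hab.le)]
  rw [hGa, hGb, hconst]

theorem energy_step_of_pos (H : FrictionFlow Kp Ki Kd Fc t₀ x₁ x₂ v w)
    (hJ : ∀ t, HasDerivAt J (v t ^ 2) t) {t ε y : ℝ} (ht : t₀ ≤ t) (hε : 0 < ε) (hy : t < y)
    (hpos : ∀ᶠ s in 𝓝[>] t, 0 < v s)
    (hpen : frictionPenalty Fc (v t) (-Ki * x₁ t - Kp * x₂ t) =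
      (-Ki * x₁ t - Kp * x₂ t - Fc) ^ 2) :
    ∃ s ∈ Set.Ioc t y, frictionEnergy Kp Ki Kd Fc x₁ x₂ v J s ≤
      frictionEnergy Kp Ki Kd Fc x₁ x₂ v J t + ε * (s - t) := by
  obtain ⟨b, hb, hsub⟩ := mem_nhdsGT_iff_exists_Ioc_subset.1 hpos
  have hb : t < b := hb
  refine ⟨min b y, ⟨lt_min hb hy, min_le_right _ _⟩, ?_⟩
  rw [H.energy_eq_of_pos hJ ht (lt_min hb hy)
    (fun s h₁ h₂ => hsub ⟨h₁, h₂.trans (min_le_left _ _)⟩) hpen]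
  nlinarith [lt_min hb hy]

/-- At rest, the velocity becomes positive only if the force exceeds the Coulomb level. -/
theorem le_force_of_pos (H : FrictionFlow Kp Ki Kd Fc t₀ x₁ x₂ v w) {t : ℝ} (ht : t₀ ≤ t)
    (hv : v t = 0) (hpos : ∀ᶠ s in 𝓝[>] t, 0 < v s) : Fc ≤ -Ki * x₁ t - Kp * x₂ t := by
  obtain ⟨b, hb, hsub⟩ := mem_nhdsGT_iff_exists_Ioc_subset.1 hpos
  have hd := (H.deriv_free t).hasDerivWithinAt (s := Set.Ioi t)
  rw [hasDerivWithinAt_iff_tendsto_slope' (by simp)] at hd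
  rw [hv, mul_zero, sub_zero] at hd
  refine ge_of_tendsto hd ?_
  filter_upwards [Ioc_mem_nhdsGT (show t < b from hb)] with s hs
  have h := H.friction_pos t s ht hs.1.le fun r h₁ h₂ => hsub ⟨h₁, h₂.le.trans hs.2⟩
  have h' : 0 < v s := hsub hs
  rw [slope_def_field, le_div_iff₀ (sub_pos.2 hs.1)]
  linarith

/-- At rest, a force above the Coulomb level makes the velocity positive. -/
theorem eventually_pos_of_lt_force (H : FrictionFlow Kp Ki Kd Fc t₀ x₁ x₂ v w) {t : ℝ}
    (ht : t₀ ≤ t) (hv : v t = 0) (hφ : Fc < -Ki * x₁ t - Kp * x₂ t) :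
    ∀ᶠ s in 𝓝[>] t, 0 < v s := by
  have hd := (H.deriv_free t).hasDerivWithinAt (s := Set.Ioi t)
  rw [hasDerivWithinAt_iff_tendsto_slope' (by simp)] at hd
  rw [hv, mul_zero, sub_zero] at hd
  filter_upwards [hd.eventually_const_lt hφ, self_mem_nhdsWithin] with s hs (hts : t < s)
  rw [slope_def_field, lt_div_iff₀ (sub_pos.2 hts)] at hs
  have := (abs_le.1 (H.friction_le t s ht hts.le)).1
  linarith

/-- At rest and at a force below the Coulomb level, the energy does not grow at first order along
later instants of rest. -/
theorem energy_step_of_frequently_zero (H : FrictionFlow Kp Ki Kd Fc t₀ x₁ x₂ v w)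
    (hJ : ∀ t, HasDerivAt J (v t ^ 2) t) {t ε y : ℝ} (hε : 0 < ε) (hy : t < y)
    (hv : v t = 0) (hφ : |-Ki * x₁ t - Kp * x₂ t| ≤ Fc) (hz : ∃ᶠ s in 𝓝[>] t, v s = 0) :
    ∃ s ∈ Set.Ioc t y, frictionEnergy Kp Ki Kd Fc x₁ x₂ v J s ≤
      frictionEnergy Kp Ki Kd Fc x₁ x₂ v J t + ε * (s - t) := by
  set φ : ℝ → ℝ := fun s => -Ki * x₁ s - Kp * x₂ s with hφdef
  -- At instants of rest the terms containing `v` vanish. With the dead-zone term replaced by its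
  -- majorant (φ s - φ t)², the energy has derivative zero at `t`.
  have hd := ((((H.deriv_error t).pow 2).const_mul (Kd * Ki)).add
    ((hJ t).const_mul (2 * (Kd * Kp - Ki)))).add (((H.hasDerivAt_force t).sub_const (φ t)).pow 2)
  have hd := (hd.congr_deriv (show _ = (0 : ℝ) by simp [hv, hφdef])).hasDerivWithinAt
    (s := Set.Ioi t)
  rw [hasDerivWithinAt_iff_tendsto_slope' (by simp)] at hd
  obtain ⟨s, hs0, hs, hts⟩ := (hz.and_eventually ((hd.eventually_lt_const hε).and
    (Ioc_mem_nhdsGT hy))).exists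
  refine ⟨s, hts, ?_⟩
  rw [slope_def_field, div_lt_iff₀ (sub_pos.2 hts.1)] at hs
  have hpen : (max (|φ s| - Fc) 0) ^ 2 ≤ (φ s - φ t) ^ 2 := by
    rw [← sq_abs (φ s - φ t)]
    have h0 : (0 : ℝ) ≤ max (|φ s| - Fc) 0 := le_max_right _ _
    gcongr
    exact max_le (by linarith [abs_sub_abs_le_abs_sub (φ s) (φ t)]) (abs_nonneg _)
  have hpt : max (|φ t| - Fc) 0 = 0 := max_eq_right (by linarith)
  simp only [frictionEnergy, hv, hs0, frictionPenalty_zero]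
  change _ + (max (|φ s| - Fc) 0) ^ 2 ≤ _ + (max (|φ t| - Fc) 0) ^ 2 + _
  rw [hpt]
  simp only [Pi.add_apply, Pi.pow_apply] at hs
  change _ + (φ s - φ t) ^ 2 - (_ + (φ t - φ t) ^ 2) < _ at hs
  nlinarith

/-- At rest, a force beyond the Coulomb level starts slip. Otherwise either zeros of `v` accumulate
from the right, or `v` keeps one sign there, which forces |φ| = Fc, where the slip and rest
penalties agree. -/
theorem energy_step (H : FrictionFlow Kp Ki Kd Fc t₀ x₁ x₂ v w) (hFc : 0 < Fc)
    (hJ : ∀ t, HasDerivAt J (v t ^ 2) t) {t ε y : ℝ} (ht : t₀ ≤ t) (hε : 0 < ε) (hy : t < y) :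
    ∃ s ∈ Set.Ioc t y, frictionEnergy Kp Ki Kd Fc x₁ x₂ v J s ≤
      frictionEnergy Kp Ki Kd Fc x₁ x₂ v J t + ε * (s - t) := by
  have hJ' : ∀ t, HasDerivAt J ((-v) t ^ 2) t := fun t => by simpa using hJ t
  -- Stated for an arbitrary flow so that it also applies to the reflected one.
  have move : ∀ {x₁ x₂ v w : ℝ → ℝ}, FrictionFlow Kp Ki Kd Fc t₀ x₁ x₂ v w →
      (∀ t, HasDerivAt J (v t ^ 2) t) → v t = 0 →
      (Fc < -Ki * x₁ t - Kp * x₂ t ∨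
        |-Ki * x₁ t - Kp * x₂ t| ≤ Fc ∧ ∀ᶠ s in 𝓝[>] t, 0 < v s) →
      ∃ s ∈ Set.Ioc t y, frictionEnergy Kp Ki Kd Fc x₁ x₂ v J s ≤
        frictionEnergy Kp Ki Kd Fc x₁ x₂ v J t + ε * (s - t) := by
    intro x₁ x₂ v w H hJ hv h
    rcases h with h | ⟨h, hpos⟩
    · refine H.energy_step_of_pos hJ ht hε hy (H.eventually_pos_of_lt_force ht hv h) ?_
      rw [hv, frictionPenalty_zero, abs_of_pos (hFc.trans h), max_eq_left (by linarith)]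
    · refine H.energy_step_of_pos hJ ht hε hy hpos ?_
      have h' := H.le_force_of_pos ht hv hpos
      rw [le_antisymm ((le_abs_self _).trans h) h', hv, frictionPenalty_zero, abs_of_pos hFc]
      simp
  have moveNeg : v t = 0 → (-Ki * x₁ t - Kp * x₂ t < -Fc ∨
        |-Ki * x₁ t - Kp * x₂ t| ≤ Fc ∧ ∀ᶠ s in 𝓝[>] t, v s < 0) →
      ∃ s ∈ Set.Ioc t y, frictionEnergy Kp Ki Kd Fc x₁ x₂ v J s ≤
        frictionEnergy Kp Ki Kd Fc x₁ x₂ v J t + ε * (s - t) := by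
    intro hv h
    have key := move H.neg hJ' (by simp [hv]) (by
      simp only [Pi.neg_apply]
      rw [show -Ki * -x₁ t - Kp * -x₂ t = -(-Ki * x₁ t - Kp * x₂ t) by ring, abs_neg]
      exact h.imp (fun h => by linarith)
        fun h => ⟨h.1, h.2.mono fun s hs => neg_pos.2 hs⟩)
    simpa only [frictionEnergy_neg] using key
  rcases lt_trichotomy (v t) 0 with h | h | h
  · have key := H.neg.energy_step_of_pos hJ' ht hε hy
      ((H.cont.continuousAt.eventually_lt_const h).filter_mono nhdsWithin_le_nhds |>.mono
        fun s hs => neg_pos.2 hs) (frictionPenalty_pos (neg_pos.2 h))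
    simpa only [frictionEnergy_neg] using key
  · by_cases h₁ : Fc < -Ki * x₁ t - Kp * x₂ t
    · exact move H hJ h (Or.inl h₁)
    by_cases h₂ : -Ki * x₁ t - Kp * x₂ t < -Fc
    · exact moveNeg h (Or.inl h₂)
    have habs : |-Ki * x₁ t - Kp * x₂ t| ≤ Fc := abs_le.2 ⟨not_lt.1 h₂, not_lt.1 h₁⟩
    by_cases hz : ∃ᶠ s in 𝓝[>] t, v s = 0
    · exact H.energy_step_of_frequently_zero hJ hε hy h habs hz
    obtain ⟨b, hb, hsub⟩ := mem_nhdsGT_iff_exists_Ioc_subset.1 (not_frequently.1 hz)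
    have hb : t < b := hb
    have hne : ∀ s ∈ Set.Ioc t b, v s ≠ 0 := fun s hs => hsub hs
    rcases (hne b ⟨hb, le_rfl⟩).lt_or_gt with hvb | hvb
    · refine moveNeg h (Or.inr ⟨habs, ?_⟩)
      filter_upwards [Ioc_mem_nhdsGT hb] with s hs
      by_contra hcon
      obtain ⟨r, hr, hr0⟩ := intermediate_value_Icc' hs.2 H.cont.continuousOn
        ⟨hvb.le, not_lt.1 hcon⟩
      exact hne r ⟨hs.1.trans_le hr.1, hr.2⟩ hr0
    · refine move H hJ h (Or.inr ⟨habs, ?_⟩)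
      filter_upwards [Ioc_mem_nhdsGT hb] with s hs
      by_contra hcon
      obtain ⟨r, hr, hr0⟩ := intermediate_value_Icc hs.2 H.cont.continuousOn
        ⟨not_lt.1 hcon, hvb.le⟩
      exact hne r ⟨hs.1.trans_le hr.1, hr.2⟩ hr0
  · exact H.energy_step_of_pos hJ ht hε hy
      ((H.cont.continuousAt.eventually_const_lt h).filter_mono nhdsWithin_le_nhds)
      (frictionPenalty_pos h)

theorem energy_le (H : FrictionFlow Kp Ki Kd Fc t₀ x₁ x₂ v w) (hFc : 0 < Fc)
    (hJ : ∀ t, HasDerivAt J (v t ^ 2) t) {t : ℝ} (ht : t₀ ≤ t) :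
    frictionEnergy Kp Ki Kd Fc x₁ x₂ v J t ≤ frictionEnergy Kp Ki Kd Fc x₁ x₂ v J t₀ :=
  (H.lowerSemicontinuous_energy hFc hJ).le_of_forall_exists_gt ht
    fun _ hs _ hε _ hy => H.energy_step hFc hJ hs.1 hε hy

end FrictionFlow

/-! ### Boundedness and convergence -/

theorem abs_sub_le_of_abs_deriv_le {f f' : ℝ → ℝ} {a b C : ℝ} (hab : a ≤ b)
    (hf : ∀ t, HasDerivAt f (f' t) t) (hC : ∀ t, a ≤ t → t ≤ b → |f' t| ≤ C) :
    |f b - f a| ≤ C * (b - a) :=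
  norm_image_sub_le_of_norm_deriv_le_segment' (fun t _ => (hf t).hasDerivWithinAt)
    (fun t ht => hC t ht.1 ht.2.le) b (Set.right_mem_Icc.2 hab)

/-- A form of Barbalat's lemma. -/
theorem tendsto_zero_of_lipschitz_of_bounded_integral_sq {v J : ℝ → ℝ} {t₀ L C : ℝ}
    (hv : ∀ a b, t₀ ≤ a → a ≤ b → |v b - v a| ≤ L * (b - a))
    (hJ : ∀ t, HasDerivAt J (v t ^ 2) t) (hC : ∀ t, t₀ ≤ t → J t ≤ C) :
    Tendsto v atTop (𝓝 0) := by
  have hmono : Monotone J := monotone_of_hasDerivAt_nonneg hJ fun t => sq_nonneg _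
  have hbdd : BddAbove (Set.range J) := ⟨C, by
    rintro _ ⟨t, rfl⟩
    exact (hmono (le_max_left t t₀)).trans (hC _ (le_max_right _ _))⟩
  have hlim := tendsto_atTop_ciSup hmono hbdd
  rw [Metric.tendsto_atTop']
  intro ε hε
  -- Over time δ the velocity changes by at most ε/2, so |v| ≥ ε would cost `J` at least (ε/2)² δ.
  set δ := ε / (2 * (|L| + 1)) with hδ
  have hL : 0 < 2 * (|L| + 1) := by positivity
  have hδ0 : 0 < δ := by positivity
  have hdiff : Tendsto (fun t => J (t + δ) - J t) atTop (𝓝 0) := by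
    simpa using (hlim.comp (tendsto_atTop_add_const_right atTop δ tendsto_id)).sub hlim
  obtain ⟨N, hN⟩ := eventually_atTop.1
    ((hdiff.eventually_lt_const (show 0 < (ε / 2) ^ 2 * δ by positivity)).and
      (eventually_ge_atTop t₀))
  refine ⟨N, fun t ht => ?_⟩
  obtain ⟨h₁, h₂⟩ := hN t ht.le
  rw [Real.dist_0_eq_abs]
  by_contra! hcon
  have hlow : ∀ s ∈ Set.Icc t (t + δ), (ε / 2) ^ 2 ≤ v s ^ 2 := by
    intro s hs
    have h := hv t s h₂ hs.1
    have hLs : L * (s - t) ≤ ε / 2 := by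
      calc L * (s - t) ≤ (|L| + 1) * δ := by
            apply mul_le_mul (by linarith [le_abs_self L]) (by linarith [hs.2])
              (by linarith [hs.1]) (by positivity)
        _ = ε / 2 := by rw [hδ]; field_simp
    rw [← sq_abs (v s)]
    have := abs_sub_abs_le_abs_sub (v t) (v s)
    rw [abs_sub_comm] at this
    gcongr
    linarith
  have := (convex_Icc t (t + δ)).mul_sub_le_image_sub_of_le_deriv
    (fun s _ => (hJ s).continuousAt.continuousWithinAt)
    (fun s _ => (hJ s).differentiableAt.differentiableWithinAt)
    (fun s hs => by rw [(hJ s).deriv]; exact hlow s (interior_subset hs))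
    t ⟨le_rfl, by linarith⟩ (t + δ) ⟨by linarith, le_rfl⟩ (by linarith)
  rw [add_sub_cancel_left] at this
  linarith

namespace FrictionFlow

variable {Kp Ki Kd Fc t₀ : ℝ} {x₁ x₂ v w : ℝ → ℝ}

/-- Two completions of the square, `hQ₁` and `hQ₂`, bound x₂ and v separately; the penalty bounds φ
and the dissipation bounds `J`. -/
theorem exists_bound (H : FrictionFlow Kp Ki Kd Fc t₀ x₁ x₂ v w) (hKp : 0 < Kp) (hKi : 0 < Ki)
    (hKd : 0 < Kd) (hFc : 0 < Fc) (hRH : Ki < Kd * Kp) {J : ℝ → ℝ}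
    (hJ : ∀ t, HasDerivAt J (v t ^ 2) t) :
    ∃ M, 0 < M ∧ ∀ t, t₀ ≤ t →
      |x₂ t| ≤ M ∧ |v t| ≤ M ∧ |-Ki * x₁ t - Kp * x₂ t| ≤ M ∧ J t - J t₀ ≤ M := by
  set D := Kd * Kp - Ki with hD
  have hD0 : 0 < D := sub_pos.2 hRH
  set E := frictionEnergy Kp Ki Kd Fc x₁ x₂ v J t₀ - 2 * D * J t₀ with hE
  have key : ∀ t, t₀ ≤ t → Ki * D * x₂ t ^ 2 ≤ Kp * E ∧ D * v t ^ 2 ≤ Kd * E ∧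
      (max (|-Ki * x₁ t - Kp * x₂ t| - Fc) 0) ^ 2 ≤ E ∧ 2 * D * (J t - J t₀) ≤ E := by
    intro t ht
    have hle := H.energy_le hFc hJ ht
    have hpen := deadzone_sq_le_frictionPenalty (v := v t) (φ := -Ki * x₁ t - Kp * x₂ t) hFc
    have hJm : 0 ≤ J t - J t₀ :=
      sub_nonneg.2 (monotone_of_hasDerivAt_nonneg hJ (fun t => sq_nonneg _) ht)
    set Q := Kd * Ki * x₂ t ^ 2 + 2 * Ki * x₂ t * v t + Kp * v t ^ 2 with hQ
    have hQ₁ : Kp * Q = (Kp * v t + Ki * x₂ t) ^ 2 + Ki * D * x₂ t ^ 2 := by rw [hQ, hD]; ring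
    have hQ₂ : Kd * Q = Ki * (Kd * x₂ t + v t) ^ 2 + D * v t ^ 2 := by rw [hQ, hD]; ring
    have hQ0 : 0 ≤ Q := by
      have : 0 ≤ Kp * Q := by rw [hQ₁]; positivity
      exact nonneg_of_mul_nonneg_right this hKp
    have hsum : Q + 2 * D * (J t - J t₀) +
        frictionPenalty Fc (v t) (-Ki * x₁ t - Kp * x₂ t) ≤ E := by
      rw [hE]
      have : frictionEnergy Kp Ki Kd Fc x₁ x₂ v J t = Q + 2 * D * J t +
        frictionPenalty Fc (v t) (-Ki * x₁ t - Kp * x₂ t) := rfl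
      linarith
    have hz := sq_nonneg (max (|-Ki * x₁ t - Kp * x₂ t| - Fc) 0)
    have hDJ : 0 ≤ 2 * D * (J t - J t₀) := by positivity
    have hQE : Q ≤ E := by linarith
    refine ⟨?_, ?_, by linarith, by linarith⟩
    · linarith [mul_le_mul_of_nonneg_left hQE hKp.le, sq_nonneg (Kp * v t + Ki * x₂ t)]
    · linarith [mul_le_mul_of_nonneg_left hQE hKd.le,
        mul_nonneg hKi.le (sq_nonneg (Kd * x₂ t + v t))]
  have hE0 : 0 ≤ E := (sq_nonneg _).trans (key t₀ le_rfl).2.2.1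
  have habs : ∀ {a c : ℝ}, a ^ 2 ≤ c → |a| ≤ c + 1 := fun {a c} h => by
    nlinarith [sq_abs a, sq_nonneg (|a| - 1), abs_nonneg a]
  have p₁ : 0 ≤ Kp * E / (Ki * D) := by positivity
  have p₂ : 0 ≤ Kd * E / D := by positivity
  have p₃ : 0 ≤ E / (2 * D) := by positivity
  refine ⟨Kp * E / (Ki * D) + Kd * E / D + E / (2 * D) + E + Fc + 1, by positivity,
    fun t ht => ?_⟩
  obtain ⟨h₁, h₂, h₃, h₄⟩ := key t ht
  refine ⟨?_, ?_, ?_, ?_⟩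
  · have := habs ((le_div_iff₀' (by positivity)).2 h₁)
    linarith
  · have := habs ((le_div_iff₀' (by positivity)).2 h₂)
    linarith
  · have := (le_abs_self _).trans (habs h₃)
    linarith [le_max_left (|-Ki * x₁ t - Kp * x₂ t| - Fc) 0]
  · have := (le_div_iff₀' (by positivity)).2 h₄
    linarith

/-- Over a window in which the velocity is small, the mean force is at most the Coulomb level. -/
theorem eventually_abs_force_le (H : FrictionFlow Kp Ki Kd Fc t₀ x₁ x₂ v w) (hKp : 0 < Kp)
    (hKi : 0 < Ki) (hKd : 0 < Kd) (hv : Tendsto v atTop (𝓝 0)) {T δ : ℝ} (hT : 0 < T)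
    (hδ : 0 < δ) :
    ∀ᶠ t in atTop, |-Ki * x₁ t - Kp * x₂ t - Ki * x₂ t * (T / 2)| ≤ Fc + δ := by
  -- Total error K η = δ T: 2 η from `v` at the endpoints, the rest from the affine approximation of
  -- φ and from damping.
  set K := 2 + ((Ki * T + Kp) * T + Kd) * T with hK
  have hK0 : 0 < K := by positivity
  set η := δ * T / K with hη
  have hη0 : 0 < η := by positivity
  have hKη : K * η = δ * T := by rw [hη]; field_simp
  have hsmall : ∀ᶠ t in atTop, |v t| ≤ η := by
    have := hv.abs
    rw [abs_zero] at this
    exact (this.eventually_lt_const hη0).mono fun _ h => h.le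
  filter_upwards [eventually_forall_ge_atTop.2 hsmall, eventually_ge_atTop t₀] with t hvt ht
  have herr : ∀ s, t ≤ s → s ≤ t + T → |x₂ s - x₂ t| ≤ η * T := fun s h₁ h₂ =>
    (abs_sub_le_of_abs_deriv_le h₁ H.deriv_error fun r hr _ => hvt r hr).trans
      (mul_le_mul_of_nonneg_left (by linarith) hη0.le)
  have hforce : ∀ s, t ≤ s → s ≤ t + T →
      |-Ki * x₁ s - Kp * x₂ s - (-Ki * x₁ t - Kp * x₂ t) + Ki * x₂ t * (s - t)| ≤
        (Ki * (η * T) + Kp * η) * T := fun s h₁ h₂ => by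
    have hd := fun r => (H.hasDerivAt_force r).add
      (((hasDerivAt_id r).sub_const t).const_mul (Ki * x₂ t))
    have h := abs_sub_le_of_abs_deriv_le h₁ hd (C := Ki * (η * T) + Kp * η) fun r hr hr' => by
      have e₁ := abs_le.1 (herr r hr (hr'.trans h₂))
      have e₂ := abs_le.1 (hvt r hr)
      rw [abs_le]
      constructor <;> nlinarith
    refine le_trans (le_of_eq ?_) (h.trans (mul_le_mul_of_nonneg_left (by linarith)
      (by positivity)))
    congr 1
    simp only [Pi.add_apply, id]
    ring
  -- Subtract the primitive of the affine approximation; over the window it equals T (φ - Ki x₂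
  -- T/2).
  have hd := fun r => (H.deriv_free r).sub
    ((((hasDerivAt_id r).sub_const t).const_mul (-Ki * x₁ t - Kp * x₂ t)).sub
      ((((hasDerivAt_id r).sub_const t).pow 2).const_mul (Ki * x₂ t / 2)))
  have hw := abs_sub_le_of_abs_deriv_le (a := t) (b := t + T) (by linarith) hd
    (C := (Ki * (η * T) + Kp * η) * T + Kd * η) fun r hr hr' => by
      have e₁ := abs_le.1 (hforce r hr hr')
      have e₂ := abs_le.1 (hvt r hr)
      have e₃ := mul_le_mul_of_nonneg_left e₂.1 hKd.le
      have e₄ := mul_le_mul_of_nonneg_left e₂.2 hKd.le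
      push_cast
      simp only [id]
      rw [abs_le]
      constructor <;> linarith
  simp only [Pi.sub_apply, Pi.pow_apply, id, sub_self, add_sub_cancel_left] at hw
  have hfr := abs_le.1 (H.friction_le t (t + T) ht (by linarith))
  rw [add_sub_cancel_left] at hfr
  have hw := abs_le.1 hw
  have e₁ := abs_le.1 (hvt t le_rfl)
  have e₂ := abs_le.1 (hvt (t + T) (by linarith))
  have hKη' : 2 * η + ((Ki * (η * T) + Kp * η) * T + Kd * η) * T = δ * T := by
    rw [← hKη, hK]; ring
  rw [abs_le]
  constructor
  · refine le_of_mul_le_mul_right ?_ hT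
    linarith
  · refine le_of_mul_le_mul_right ?_ hT
    linarith

theorem tendsto_zero (H : FrictionFlow Kp Ki Kd Fc t₀ x₁ x₂ v w) (hKp : 0 < Kp) (hKi : 0 < Ki)
    (hKd : 0 < Kd) (hFc : 0 < Fc) (hRH : Ki < Kd * Kp) :
    Tendsto v atTop (𝓝 0) ∧ Tendsto x₂ atTop (𝓝 0) ∧
      Tendsto (fun t => max (|Ki * x₁ t| - Fc) 0) atTop (𝓝 0) := by
  have hvc := H.cont
  have hJ := hasDerivAt_add_integral (show Continuous fun t => v t ^ 2 by fun_prop) 0 t₀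
  obtain ⟨M, hM, hbd⟩ := H.exists_bound hKp hKi hKd hFc hRH hJ
  have hv : Tendsto v atTop (𝓝 0) := by
    refine tendsto_zero_of_lipschitz_of_bounded_integral_sq (L := Fc + (M + Kd * M))
      (fun a b ha hab => ?_) hJ fun t ht => sub_le_iff_le_add.1 (hbd t ht).2.2.2
    have hw := abs_sub_le_of_abs_deriv_le hab H.deriv_free (C := M + Kd * M) fun t h₁ h₂ => by
      obtain ⟨-, g₂, g₃, -⟩ := hbd t (ha.trans h₁)
      refine (abs_sub _ _).trans (add_le_add g₃ ?_)
      rw [abs_mul, abs_of_pos hKd]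
      exact mul_le_mul_of_nonneg_left g₂ hKd.le
    have hf := H.friction_le a b ha hab
    have := abs_sub_abs_le_abs_sub (v b - v a) (w b - w a)
    linarith
  have hx₂ : ∀ ε > 0, ∀ᶠ t in atTop, |x₂ t| ≤ ε := by
    intro ε hε
    -- Chosen so that Ki ε T/2 = M + Fc + 1, the bound on |φ| plus the bound on the mean force.
    have hT : 0 < 2 * (M + Fc + 1) / (Ki * ε) := by positivity
    filter_upwards [H.eventually_abs_force_le hKp hKi hKd hv hT one_pos, eventually_ge_atTop t₀]
      with t h ht
    set T := 2 * (M + Fc + 1) / (Ki * ε) with hTdef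
    have hTε : Ki * ε * (T / 2) = M + Fc + 1 := by rw [hTdef]; field_simp
    have hφ := (hbd t ht).2.2.1
    have h' : |Ki * x₂ t * (T / 2)| ≤ M + (Fc + 1) := by
      rw [abs_le] at h hφ ⊢
      constructor <;> linarith [h.1, h.2, hφ.1, hφ.2]
    rw [abs_mul, abs_mul, abs_of_pos hKi, abs_of_pos (half_pos hT)] at h'
    have : Ki * |x₂ t| * (T / 2) ≤ Ki * ε * (T / 2) := by linarith
    exact le_of_mul_le_mul_left (le_of_mul_le_mul_right this (half_pos hT)) hKi
  have hx₂' : Tendsto x₂ atTop (𝓝 0) := by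
    rw [Metric.tendsto_nhds]
    intro ε hε
    filter_upwards [hx₂ (ε / 2) (half_pos hε)] with t ht
    rw [Real.dist_0_eq_abs]
    linarith
  refine ⟨hv, hx₂', ?_⟩
  rw [Metric.tendsto_nhds]
  intro ε hε
  -- Window length 1: the averaging error and (Kp + Ki) |x₂| each take at most ε/4.
  filter_upwards [H.eventually_abs_force_le hKp hKi hKd hv one_pos (show 0 < ε / 4 by linarith),
    hx₂ (ε / (4 * (Kp + Ki))) (by positivity)] with t h₁ h₂
  rw [Real.dist_0_eq_abs, abs_of_nonneg (le_max_right _ _)]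
  refine max_lt ?_ hε
  rw [le_div_iff₀ (by positivity)] at h₂
  have hsum : |Ki * x₁ t| ≤ (Fc + ε / 4) + (Kp + Ki) * |x₂ t| := by
    have e₁ := abs_le.1 h₁
    have e₂ := mul_le_mul_of_nonneg_left (neg_abs_le (x₂ t)) (add_pos hKp (half_pos hKi)).le
    have e₃ := mul_le_mul_of_nonneg_left (le_abs_self (x₂ t)) (add_pos hKp (half_pos hKi)).le
    have e₄ := mul_nonneg hKi.le (abs_nonneg (x₂ t))
    rw [abs_le]
    constructor <;> linarith
  linarith

end FrictionFlow

/-! ### Distance to the stiction region -/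

/-- The comparison point clips Ki x₁ to [-Fc, Fc] and sets the other coordinates to zero. -/
theorem infDist_stictionRegion_le {Kp Ki Fc : ℝ} (hKi : 0 < Ki) (hFc : 0 < Fc) (x : PIDState) :
    Metric.infDist x (stictionRegion Kp Ki Fc) ≤
      max (|Ki * x 0| - Fc) 0 / Ki + |x 1| + |x 2| := by
  obtain ⟨y, hy, hxy⟩ : ∃ y, |Ki * y| ≤ Fc ∧ |Ki * x 0 - Ki * y| ≤ max (|Ki * x 0| - Fc) 0 := by
    have hc : Ki * (Fc / Ki) = Fc := mul_div_cancel₀ _ hKi.ne'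
    have hc' : Ki * -(Fc / Ki) = -Fc := by rw [mul_neg, hc]
    rcases le_or_gt (|Ki * x 0|) Fc with h | h
    · exact ⟨x 0, h, by simp⟩
    · rcases lt_abs.1 h with h' | h'
      · refine ⟨Fc / Ki, by rw [hc, abs_of_pos hFc], ?_⟩
        rw [hc, abs_of_pos (hFc.trans h'), abs_of_pos (sub_pos.2 h')]
        exact le_max_left _ _
      · refine ⟨-(Fc / Ki), by rw [hc', abs_neg, abs_of_pos hFc], ?_⟩
        rw [hc', abs_of_neg (by linarith), abs_of_neg (by linarith)]
        exact le_max_of_le_left (by linarith)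
  have hmem : (!₂[y, 0, 0] : PIDState) ∈ stictionRegion Kp Ki Fc := by
    simpa [stictionRegion] using hy
  refine (Metric.infDist_le_dist_of_mem hmem).trans ?_
  have hxy' : |x 0 - y| ≤ max (|Ki * x 0| - Fc) 0 / Ki := by
    rw [le_div_iff₀' hKi]
    rwa [← mul_sub, abs_mul, abs_of_pos hKi] at hxy
  refine le_trans ?_ (add_le_add_left (add_le_add_left hxy' _) _)
  rw [EuclideanSpace.dist_eq, Fin.sum_univ_three]
  refine Real.sqrt_le_iff.2 ⟨by positivity, ?_⟩
  simp only [Real.dist_eq, Matrix.cons_val_zero, Matrix.cons_val_one,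
    Matrix.cons_val, sub_zero]
  have h₁ := mul_nonneg (abs_nonneg (x 0 - y)) (abs_nonneg (x 1))
  have h₂ := mul_nonneg (abs_nonneg (x 0 - y)) (abs_nonneg (x 2))
  have h₃ := mul_nonneg (abs_nonneg (x 1)) (abs_nonneg (x 2))
  linarith

theorem corollary1 (Kp Ki Kd Fc : ℝ) (hKp : 0 < Kp) (hKi : 0 < Ki) (hKd : 0 < Kd) (hFc : 0 < Fc)
    (hRH : Ki < Kd * Kp) :
    ∀ x₀ : PIDState, x₀ ∉ stictionRegion Kp Ki Fc →
      Attracts Kp Ki Kd Fc (stictionRegion Kp Ki Fc) x₀ := by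
  intro x₀ _ t₀ x hx _
  obtain ⟨x₁, x₂, v, w, H, heq⟩ := hx.exists_frictionFlow hFc
  obtain ⟨hv, hx₂, hx₁⟩ := H.tendsto_zero hKp hKi hKd hFc hRH
  have hlim : Tendsto (fun t => max (|Ki * x₁ t| - Fc) 0 / Ki + |x₂ t| + |v t|) atTop (𝓝 0) := by
    simpa using ((hx₁.div_const Ki).add hx₂.abs).add hv.abs
  refine squeeze_zero' (Eventually.of_forall fun t => Metric.infDist_nonneg) ?_ hlim
  filter_upwards [eventually_ge_atTop t₀] with t ht
  obtain ⟨e₁, e₂, e₃⟩ := heq t ht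
  rw [← e₁, ← e₂, ← e₃]
  exact infDist_stictionRegion_le hKi hFc (x t)
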